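/- Let $n \ge 1$, let $p<0$ and $0<q<1$ satisfy $\frac1p+\frac1q=1$, and let $X_1,\dots,X_n$ be independent real random variables with a common density function $f$ (with respect to Lebesgue measure) that vanishes on $(-\infty,0)$. Suppose that $X_1^p$ has a density function $g:\mathbb R\to[0,\infty)$ that is log-concave, i.e. $g(\alpha x+(1-\alpha)y)\ge g(x)^{\alpha}g(y)^{1-\alpha}$ for all $x,y\in\mathbb R$ and $\alpha\in[0,1]$. For $x\in\mathbb R^n$ let $x_{(1)}\le\cdots\le x_{(n)}$ be the increasing arrangement of its components. Let $a,b\in[0,\infty)^n$ be such that $(b_1^q,\dots,b_n^q)$ is weakly submajorized by $(a_1^q,\dots,a_n^q)$: writing $x_i=b_i^q$ and $y_i=a_i^q$, $$\sum_{i=j}^n x_{(i)}\le\sum_{i=j}^n y_{(i)}\qquad\text{for } j=1,\dots,n.$$ Then $\sum_{i=1}^n a_iX_i\ge_{\mathrm{st}}\sum_{i=1}^n b_iX_i$ in the usual stochastic order, i.e. $$\Pr\Bigl(\sum_{i=1}^n a_iX_i\le t\Bigr)\le \Pr\Bigl(\sum_{i=1}^n b_iX_i\le t\Bigr)\qquad\text{for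 all } t\in\mathbb R.$$ -/

import Mathlib

open MeasureTheory ProbabilityTheory

/-- `x` is weakly submajorized by `y`. Here `Tuple.sort x` is a permutation that arranges the
components of `x` in increasing order, so that `x (Tuple.sort x i)` is the order statistic
`x_(i)`, and `Finset.Ici j` is the set of indices from `j` to the last one. -/
def WeaklySubmajorizedBy {n : ℕ} (x y : Fin n → ℝ) : Prop :=
  ∀ j : Fin n, ∑ i ∈ Finset.Ici j, x (Tuple.sort x i) ≤ ∑ i ∈ Finset.Ici j, y (Tuple.sort y i)

/-- A nonnegative function `h` is log-concave on the convex set `A`. -/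
def LogConcaveOn (A : Set ℝ) (h : ℝ → ℝ) : Prop :=
  Convex ℝ A ∧ (∀ x ∈ A, 0 ≤ h x) ∧
    ∀ x ∈ A, ∀ y ∈ A, ∀ α ∈ Set.Icc (0 : ℝ) 1,
      h x ^ α * h y ^ (1 - α) ≤ h (α * x + (1 - α) * y)

/-- The real random variable `Y` has the density function `g` with respect to
Lebesgue measure. -/
def HasDensity {Ω : Type*} [MeasurableSpace Ω] (P : Measure Ω) (Y : Ω → ℝ) (g : ℝ → ℝ) : Prop :=
  Measurable g ∧ (∀ x, 0 ≤ g x) ∧ HasLaw Y (volume.withDensity fun x => ENNReal.ofReal (g x)) P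

/-- `Y ≤_st Z`: the distribution function of `Y` is everywhere at least that of `Z`. -/
def StochLE {Ω : Type*} [MeasurableSpace Ω] (P : Measure Ω) (Y Z : Ω → ℝ) : Prop :=
  ∀ t : ℝ, P {ω | Z ω ≤ t} ≤ P {ω | Y ω ≤ t}

open scoped ENNReal

/-! Put `Y_i = X_i ^ p`, i.i.d. with log-concave density `g`, and `c_i = a_i ^ q`. Since `1/p = 1 -
1/q`, almost surely `a_i X_i = c_i ^ (1/q) * Y_i ^ (1 - 1/q)`: the perspective of the convex
function `u ^ (1/q)`, hence jointly convex in `(c_i, Y_i)`. So the sets `S_c = {∑ a_i X_i ≤ t}`,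
viewed in `Y`-space, satisfy `l S_c + (1 - l) S_d ⊆ S_(l c + (1 - l) d)`, and Prékopa–Leindler for
the product law of `Y` makes `F c = Pr(Y ∈ S_c)` quasiconcave on the nonnegative orthant.

`F` is also symmetric and antitone. A vector weakly submajorized by `y` lies below a convex
combination of rearrangements of `y`, so `F` is at least `F y` there. -/

/-! ### Brunn–Minkowski on the line -/

/-- The one-dimensional Brunn–Minkowski inequality for compact sets. -/
theorem volume_add_volume_le_of_isCompact {A B C : Set ℝ} (hA : IsCompact A) (hB : IsCompact B)
    (hA' : A.Nonempty) (hB' : B.Nonempty) (h : ∀ x ∈ A, ∀ y ∈ B, x + y ∈ C) :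
    volume A + volume B ≤ volume C := by
  obtain ⟨m, hm, hm'⟩ := hA.exists_isGreatest hA'
  obtain ⟨k, hk, hk'⟩ := hB.exists_isLeast hB'
  have e1 : volume A = volume ((fun x => x + k) '' A) := by simp
  have e2 : volume B = volume ((fun x => m + x) '' B) := by simp
  -- `A` moved by the least point of `B` and `B` moved by the greatest point of `A` both lie in `C`
  -- and meet only at `m + k`.
  have hd : AEDisjoint volume ((fun x => x + k) '' A) ((fun x => m + x) '' B) := by
    refine measure_mono_null (t := {m + k}) ?_ (by simp)
    rintro _ ⟨⟨x, hx, rfl⟩, ⟨y, hy, hxy⟩⟩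
    have h1 := hm' hx
    have h2 := hk' hy
    simp only [Set.mem_singleton_iff] at hxy ⊢
    linarith
  have hBm : MeasurableSet ((fun x => m + x) '' B) :=
    (hB.image (by fun_prop)).measurableSet
  rw [e1, e2, ← measure_union₀ hBm.nullMeasurableSet hd]
  refine measure_mono ?_
  rintro _ (⟨x, hx, rfl⟩ | ⟨y, hy, rfl⟩)
  · exact h _ hx _ hk
  · exact h _ hm _ hy

/-- The one-dimensional Brunn–Minkowski inequality. -/
theorem volume_add_volume_le {A B C : Set ℝ} (hA : MeasurableSet A) (hB : MeasurableSet B)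
    (hA' : A.Nonempty) (hB' : B.Nonempty) (h : ∀ x ∈ A, ∀ y ∈ B, x + y ∈ C) :
    volume A + volume B ≤ volume C := by
  by_cases hA0 : volume A = 0
  · obtain ⟨a, ha⟩ := hA'
    have e2 : volume B = volume ((fun x => a + x) '' B) := by simp
    rw [hA0, zero_add, e2]
    refine measure_mono ?_
    rintro _ ⟨y, hy, rfl⟩
    exact h _ ha _ hy
  by_cases hB0 : volume B = 0
  · obtain ⟨b, hb⟩ := hB'
    have e1 : volume A = volume ((fun x => x + b) '' A) := by simp
    rw [hB0, add_zero, e1]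
    refine measure_mono ?_
    rintro _ ⟨y, hy, rfl⟩
    exact h _ hy _ hb
  refine le_of_forall_lt fun r hr => ?_
  obtain ⟨u, hu, v, hv, huv⟩ := ENNReal.exists_lt_add_of_lt_add hr hA0 hB0
  obtain ⟨K, hKA, hK, huK⟩ := hA.exists_lt_isCompact hu
  obtain ⟨L, hLB, hL, hvL⟩ := hB.exists_lt_isCompact hv
  have hKn : K.Nonempty := nonempty_of_measure_ne_zero (ne_bot_of_gt huK)
  have hLn : L.Nonempty := nonempty_of_measure_ne_zero (ne_bot_of_gt hvL)
  calc r < u + v := huv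
    _ ≤ volume K + volume L := by gcongr
    _ ≤ volume C := volume_add_volume_le_of_isCompact hK hL hKn hLn
        fun x hx y hy => h x (hKA hx) y (hLB hy)

/-- The weighted form of the one-dimensional Brunn–Minkowski inequality. -/
theorem ofReal_mul_volume_add_le {l : ℝ} (hl0 : 0 < l) (hl1 : l < 1) {A B C : Set ℝ}
    (hA : MeasurableSet A) (hB : MeasurableSet B)
    (hA' : A.Nonempty) (hB' : B.Nonempty) (h : ∀ x ∈ A, ∀ y ∈ B, l * x + (1 - l) * y ∈ C) :
    ENNReal.ofReal l * volume A + ENNReal.ofReal (1 - l) * volume B ≤ volume C := by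
  have hl : 0 < 1 - l := sub_pos.2 hl1
  have key := volume_add_volume_le (C := C) (hA.const_smul₀ l) (hB.const_smul₀ (1 - l))
    (hA'.smul_set (a := l)) (hB'.smul_set (a := 1 - l)) (by
      rintro _ ⟨x, hx, rfl⟩ _ ⟨y, hy, rfl⟩
      exact h x hx y hy)
  simpa [Measure.addHaar_smul, abs_of_pos hl0, abs_of_pos hl] using key

/-! ### Prékopa–Leindler on the line -/

theorem ENNReal.rpow_mul_rpow_le_add {l : ℝ} (hl0 : 0 < l) (hl1 : l < 1) (a b : ℝ≥0∞) :
    a ^ l * b ^ (1 - l) ≤ ENNReal.ofReal l * a + ENNReal.ofReal (1 - l) * b := by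
  have hl : 0 < 1 - l := sub_pos.2 hl1
  induction a with
  | top => simp [ENNReal.mul_top, hl0]
  | coe a =>
  induction b with
  | top => simp [ENNReal.mul_top, hl1]
  | coe b =>
  rw [← ENNReal.coe_rpow_of_nonneg _ hl0.le, ← ENNReal.coe_rpow_of_nonneg _ hl.le,
    ENNReal.ofReal, ENNReal.ofReal]
  norm_cast
  have := NNReal.geom_mean_le_arith_mean2_weighted l.toNNReal (1 - l).toNNReal a b
    (by rw [← Real.toNNReal_add hl0.le hl.le]; simp)
  simpa [Real.coe_toNNReal _ hl0.le, Real.coe_toNNReal _ hl.le] using this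

theorem ENNReal.rpow_mul_rpow_self {l : ℝ} (hl0 : 0 < l) (hl1 : l < 1) (t : ℝ≥0∞) :
    t ^ l * t ^ (1 - l) = t := by
  rw [← ENNReal.rpow_add_of_nonneg _ _ hl0.le (sub_pos.2 hl1).le]
  simp

/-- A measure satisfies the Prékopa–Leindler inequality with weight `l`. -/
def PrekopaLeindler {E : Type*} [MeasurableSpace E] [AddCommGroup E] [Module ℝ E] (l : ℝ)
    (μ : Measure E) : Prop :=
  ∀ f g h : E → ℝ≥0∞, Measurable f → Measurable g → Measurable h →
    (∀ x y, f x ^ l * g y ^ (1 - l) ≤ h (l • x + (1 - l) • y)) →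
    (∫⁻ x, f x ∂μ) ^ l * (∫⁻ x, g x ∂μ) ^ (1 - l) ≤ ∫⁻ x, h x ∂μ

theorem lintegral_eq_lintegral_volume_lt {f : ℝ → ℝ≥0∞} (hf : Measurable f) (hf1 : ∀ x, f x ≤ 1) :
    ∫⁻ x, f x = ∫⁻ t in Set.Ioi (0 : ℝ), volume {x | ENNReal.ofReal t < f x} := by
  have hfin : ∀ x, f x ≠ ∞ := fun x => ((hf1 x).trans_lt ENNReal.one_lt_top).ne
  have := lintegral_eq_lintegral_meas_lt volume (f := fun x => (f x).toReal)
    (Filter.Eventually.of_forall fun x => ENNReal.toReal_nonneg) hf.ennreal_toReal.aemeasurable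
  simp_rw [ENNReal.ofReal_toReal (hfin _)] at this
  rw [this]
  refine setLIntegral_congr_fun measurableSet_Ioi fun t ht => ?_
  simp only [ENNReal.ofReal_lt_iff_lt_toReal (le_of_lt ht) (hfin _)]

/-- The additive form of the Prékopa–Leindler inequality for functions with supremum one. -/
theorem add_lintegral_le_of_sup_eq_one {l : ℝ} (hl0 : 0 < l) (hl1 : l < 1) {f g h : ℝ → ℝ≥0∞}
    (hf : Measurable f) (hg : Measurable g) (hh : Measurable h)
    (hf1 : ∀ x, f x ≤ 1) (hg1 : ∀ x, g x ≤ 1)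
    (hfs : ∀ t < 1, ∃ x, t < f x) (hgs : ∀ t < 1, ∃ x, t < g x)
    (H : ∀ x y, f x ^ l * g y ^ (1 - l) ≤ h (l * x + (1 - l) * y)) :
    ENNReal.ofReal l * (∫⁻ x, f x) + ENNReal.ofReal (1 - l) * ∫⁻ x, g x ≤ ∫⁻ x, h x := by
  have hl : 0 < 1 - l := sub_pos.2 hl1
  calc ENNReal.ofReal l * (∫⁻ x, f x) + ENNReal.ofReal (1 - l) * ∫⁻ x, g x
      ≤ ∫⁻ x, min (h x) 1 := ?_
    _ ≤ ∫⁻ x, h x := lintegral_mono fun x => min_le_left _ _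
  rw [lintegral_eq_lintegral_volume_lt hf hf1, lintegral_eq_lintegral_volume_lt hg hg1,
    lintegral_eq_lintegral_volume_lt (hh.min measurable_const) fun x => min_le_right _ _]
  rw [← lintegral_const_mul' _ _ ENNReal.ofReal_ne_top,
    ← lintegral_const_mul' _ _ ENNReal.ofReal_ne_top]
  refine (le_lintegral_add _ _).trans (setLIntegral_mono' measurableSet_Ioi fun t ht => ?_)
  -- Below level 1 the superlevel sets of `f` and `g` are nonempty, as Brunn–Minkowski requires;
  -- from level 1 on they are empty.
  by_cases ht1 : ENNReal.ofReal t < 1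
  · refine ofReal_mul_volume_add_le hl0 hl1 (measurableSet_lt measurable_const hf)
      (measurableSet_lt measurable_const hg) (hfs _ ht1) (hgs _ ht1) fun x hx y hy => ?_
    refine lt_min (lt_of_lt_of_le ?_ (H x y)) ht1
    rw [← ENNReal.rpow_mul_rpow_self hl0 hl1 (ENNReal.ofReal t)]
    exact ENNReal.mul_lt_mul (ENNReal.rpow_lt_rpow hx hl0) (ENNReal.rpow_lt_rpow hy hl)
  · have h1 : {x | ENNReal.ofReal t < f x} = ∅ :=
      Set.eq_empty_of_forall_notMem fun x hx => ht1 (lt_of_lt_of_le hx (hf1 x))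
    have h2 : {x | ENNReal.ofReal t < g x} = ∅ :=
      Set.eq_empty_of_forall_notMem fun x hx => ht1 (lt_of_lt_of_le hx (hg1 x))
    simp [h1, h2]

/-- Dividing `f`, `g`, `h` by `M`, `N`, `M ^ l * N ^ (1 - l)` preserves the hypothesis and makes
both suprema one. The additive form and AM-GM then apply, and the constants cancel. -/
theorem prekopaLeindler_volume_of_bounded {l : ℝ} (hl0 : 0 < l) (hl1 : l < 1)
    {f g h : ℝ → ℝ≥0∞} (hf : Measurable f) (hg : Measurable g) (hh : Measurable h)
    (hfb : ⨆ x, f x ≠ ∞) (hgb : ⨆ x, g x ≠ ∞)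
    (H : ∀ x y, f x ^ l * g y ^ (1 - l) ≤ h (l * x + (1 - l) * y)) :
    (∫⁻ x, f x) ^ l * (∫⁻ x, g x) ^ (1 - l) ≤ ∫⁻ x, h x := by
  have hl : 0 < 1 - l := sub_pos.2 hl1
  set M := ⨆ x, f x with hM
  set N := ⨆ x, g x with hN
  by_cases hM0 : M = 0
  · have : ∀ x, f x = 0 := by simpa [hM] using hM0
    simp [this, hl0]
  by_cases hN0 : N = 0
  · have : ∀ x, g x = 0 := by simpa [hN] using hN0
    simp [this, hl1]
  set c := M ^ l * N ^ (1 - l) with hc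
  have hc0 : c ≠ 0 := by
    simp [hc, hM0, hN0, hfb, hgb, hl0.not_gt, hl.not_gt]
  have hct : c ≠ ∞ := by
    refine ENNReal.mul_ne_top ?_ ?_ <;> simp [hM0, hN0, hfb, hgb]
  have scale : ∀ a b : ℝ≥0∞, (M⁻¹ * a) ^ l * (N⁻¹ * b) ^ (1 - l) = c⁻¹ * (a ^ l * b ^ (1 - l)) := by
    intro a b
    rw [ENNReal.mul_rpow_of_nonneg _ _ hl0.le, ENNReal.mul_rpow_of_nonneg _ _ hl.le,
      ENNReal.inv_rpow, ENNReal.inv_rpow, hc, ENNReal.mul_inv]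
    · ring
    · right; simp [hN0, hgb]
    · left; simp [hM0, hfb]
  have sup : ∀ (u : ℝ → ℝ≥0∞) (K : ℝ≥0∞), K = ⨆ x, u x → K ≠ 0 → K ≠ ∞ →
      (∀ x, K⁻¹ * u x ≤ 1) ∧ ∀ t < 1, ∃ x, t < K⁻¹ * u x := by
    intro u K hK h0 ht
    refine ⟨fun x => ?_, fun t ht1 => ?_⟩
    · rw [mul_comm, ← div_eq_mul_inv]
      exact ENNReal.div_le_of_le_mul (by rw [one_mul, hK]; exact le_iSup u x)
    · have : t * K < ⨆ x, u x := by
        rw [← hK]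
        calc t * K < 1 * K := (ENNReal.mul_lt_mul_iff_left h0 ht).2 ht1
          _ = K := one_mul K
      obtain ⟨x, hx⟩ := lt_iSup_iff.1 this
      refine ⟨x, ?_⟩
      rw [mul_comm, ← div_eq_mul_inv]
      exact (ENNReal.lt_div_iff_mul_lt (Or.inl h0) (Or.inl ht)).2 hx
  obtain ⟨f1, fs⟩ := sup f M hM hM0 hfb
  obtain ⟨g1, gs⟩ := sup g N hN hN0 hgb
  have key := add_lintegral_le_of_sup_eq_one hl0 hl1 (hf.const_mul M⁻¹) (hg.const_mul N⁻¹)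
    (hh.const_mul c⁻¹) f1 g1 fs gs fun x y => by
      rw [scale]
      gcongr
      exact H x y
  have key' := (ENNReal.rpow_mul_rpow_le_add hl0 hl1 _ _).trans key
  rw [lintegral_const_mul _ hf, lintegral_const_mul _ hg, lintegral_const_mul _ hh, scale] at key'
  exact (ENNReal.mul_le_mul_iff_right (ENNReal.inv_ne_zero.2 hct) (ENNReal.inv_ne_top.2 hc0)).1 key'

/-- The **Prékopa–Leindler inequality** on the real line. -/
theorem prekopaLeindler_volume {l : ℝ} (hl0 : 0 < l) (hl1 : l < 1) :
    PrekopaLeindler l (volume : Measure ℝ) := by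
  intro f g h hf hg hh H
  have hl : 0 < 1 - l := sub_pos.2 hl1
  by_cases hf0 : ∫⁻ x, f x = 0
  · simp [hf0, hl0]
  by_cases hg0 : ∫⁻ x, g x = 0
  · simp [hg0, hl1]
  have lim : ∀ u : ℝ → ℝ≥0∞, Measurable u →
      Filter.Tendsto (fun n : ℕ => ∫⁻ x, min (u x) n) Filter.atTop (nhds (∫⁻ x, u x)) := by
    intro u hu
    refine lintegral_tendsto_of_tendsto_of_monotone
      (fun n => (hu.min measurable_const).aemeasurable) (Filter.Eventually.of_forall fun x => ?_)
      (Filter.Eventually.of_forall fun x => ?_)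
    · intro m n hmn
      exact min_le_min le_rfl (by exact_mod_cast hmn)
    · have := (tendsto_const_nhds (x := u x)).min ENNReal.tendsto_nat_nhds_top
      simpa using this
  have hlim := ENNReal.Tendsto.mul ((lim f hf).ennrpow_const l)
    (Or.inl (by simp [hf0, hl0.not_gt]))
    ((lim g hg).ennrpow_const (1 - l)) (Or.inl (by simp [hg0, hl.not_gt]))
  refine le_of_tendsto' hlim fun n => ?_
  have bdd : ∀ u : ℝ → ℝ≥0∞, ⨆ x, min (u x) (n : ℝ≥0∞) ≠ ∞ := fun u =>
    ((iSup_le fun x => min_le_right _ _).trans_lt (ENNReal.natCast_lt_top n)).ne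
  refine prekopaLeindler_volume_of_bounded hl0 hl1 (hf.min measurable_const)
    (hg.min measurable_const) hh (bdd f) (bdd g) fun x y => le_trans ?_ (H x y)
  gcongr <;> exact min_le_left _ _

/-! ### Prékopa–Leindler for densities and products -/

theorem PrekopaLeindler.withDensity {E : Type*} [MeasurableSpace E] [AddCommGroup E] [Module ℝ E]
    {l : ℝ} {μ : Measure E} (hl0 : 0 < l) (hl1 : l < 1)
    (hμ : PrekopaLeindler l μ) {ρ : E → ℝ≥0∞} (hρ : Measurable ρ)
    (H : ∀ x y, ρ x ^ l * ρ y ^ (1 - l) ≤ ρ (l • x + (1 - l) • y)) :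
    PrekopaLeindler l (μ.withDensity ρ) := by
  intro f g h hf hg hh hfgh
  rw [lintegral_withDensity_eq_lintegral_mul _ hρ hf,
    lintegral_withDensity_eq_lintegral_mul _ hρ hg,
    lintegral_withDensity_eq_lintegral_mul _ hρ hh]
  refine hμ _ _ _ (hρ.mul hf) (hρ.mul hg) (hρ.mul hh) fun x y => ?_
  simp only [Pi.mul_apply]
  rw [ENNReal.mul_rpow_of_nonneg _ _ hl0.le, ENNReal.mul_rpow_of_nonneg _ _ (sub_pos.2 hl1).le,
    mul_mul_mul_comm]
  exact mul_le_mul' (H x y) (hfgh x y)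

/-- By Tonelli: the inequality for `ν` on fibres is exactly the hypothesis of the inequality for `μ`
on the inner integrals. -/
theorem PrekopaLeindler.prod {E F : Type*} [MeasurableSpace E] [AddCommGroup E] [Module ℝ E]
    [MeasurableSpace F] [AddCommGroup F] [Module ℝ F] {l : ℝ} {μ : Measure E} {ν : Measure F}
    [SFinite ν] (hμ : PrekopaLeindler l μ) (hν : PrekopaLeindler l ν) :
    PrekopaLeindler l (μ.prod ν) := by
  intro f g h hf hg hh H
  rw [lintegral_prod _ hf.aemeasurable, lintegral_prod _ hg.aemeasurable,
    lintegral_prod _ hh.aemeasurable]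
  refine hμ _ _ _ hf.lintegral_prod_right' hg.lintegral_prod_right' hh.lintegral_prod_right'
    fun x y => ?_
  exact hν _ _ _ (hf.comp measurable_prodMk_left) (hg.comp measurable_prodMk_left)
    (hh.comp measurable_prodMk_left) fun u v => H (x, u) (y, v)

theorem PrekopaLeindler.pi {l : ℝ} {μ : Measure ℝ} [SigmaFinite μ]
    (hμ : PrekopaLeindler l μ) (n : ℕ) :
    PrekopaLeindler l (Measure.pi fun _ : Fin n => μ) := by
  induction n with
  | zero =>
    intro f g h hf hg hh H
    rw [Measure.pi_of_empty]
    simp only [lintegral_dirac' _ hf, lintegral_dirac' _ hg, lintegral_dirac' _ hh]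
    convert H isEmptyElim isEmptyElim using 2
  | succ n ih =>
    intro f g h hf hg hh H
    set e := (MeasurableEquiv.piFinSuccAbove (fun _ : Fin (n + 1) => ℝ) 0).symm with he
    have mp : MeasurePreserving e (μ.prod (Measure.pi fun _ : Fin n => μ))
        (Measure.pi fun _ : Fin (n + 1) => μ) :=
      (measurePreserving_piFinSuccAbove (fun _ : Fin (n + 1) => μ) 0).symm
    rw [← mp.lintegral_comp hf, ← mp.lintegral_comp hg, ← mp.lintegral_comp hh]
    refine hμ.prod ih _ _ _ (hf.comp e.measurable) (hg.comp e.measurable) (hh.comp e.measurable)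
      fun x y => ?_
    convert H (e x) (e y) using 2
    ext i
    refine Fin.cases ?_ (fun i => ?_) i <;>
      simp [he, MeasurableEquiv.piFinSuccAbove_symm_apply]

/-! ### Weak submajorization -/

/-- Abel summation: the least weight `w 0` multiplies the total sum, and the excesses over it are
again monotone and nonnegative. -/
theorem sum_mul_nonneg_of_monotone {n : ℕ} {w d : Fin n → ℝ} (hw : Monotone w) (hw0 : ∀ i, 0 ≤ w i)
    (hd : ∀ j, 0 ≤ ∑ i ∈ Finset.Ici j, d i) : 0 ≤ ∑ i, w i * d i := by
  induction n with
  | zero => simp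
  | succ n ih =>
    have h0 : 0 ≤ ∑ i, d i := by
      have := hd 0
      rwa [show Finset.Ici (0 : Fin (n + 1)) = Finset.univ from by ext; simp] at this
    have h1 := ih (w := fun i => w i.succ - w 0) (d := fun i => d i.succ)
      (fun i j hij => sub_le_sub_right (hw (Fin.succ_le_succ_iff.2 hij)) _)
      (fun i => sub_nonneg.2 (hw (Fin.zero_le _))) (fun j => by
        have := hd j.succ
        rwa [← Fin.map_succEmb_Ici, Finset.sum_map] at this)
    have h2 : ∑ i, w i * d i = w 0 * ∑ i, d i + ∑ i : Fin n, (w i.succ - w 0) * d i.succ := by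
      simp only [Fin.sum_univ_succ, sub_mul, Finset.sum_sub_distrib, mul_add, Finset.mul_sum]
      ring
    rw [h2]
    exact add_nonneg (mul_nonneg (hw0 0) h0) h1

/-- A vector weakly submajorized by `y` is dominated by a convex combination of rearrangements
of `y`. -/
theorem WeaklySubmajorizedBy.exists_le_mem_convexHull {n : ℕ} {x y : Fin n → ℝ}
    (h : WeaklySubmajorizedBy x y) :
    ∃ z ∈ convexHull ℝ (Set.range fun σ : Equiv.Perm (Fin n) => y ∘ σ), x ≤ z := by
  by_contra! hcon
  have hdisj : Disjoint (convexHull ℝ (Set.range fun σ : Equiv.Perm (Fin n) => y ∘ σ))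
      (Set.Ici x) := Set.disjoint_left.2 fun z hz hxz => hcon z hz hxz
  obtain ⟨φ, u, v, hu, huv, hv⟩ := geometric_hahn_banach_compact_closed (convex_convexHull ℝ _)
    ((Set.finite_range _).isCompact_convexHull (𝕜 := ℝ)) (convex_Ici x) isClosed_Ici hdisj
  set w : Fin n → ℝ := fun i => φ (Pi.single i 1) with hw
  have hφ : ∀ z, φ z = ∑ i, w i * z i := by
    intro z
    conv_lhs => rw [← Finset.univ_sum_single z]
    rw [map_sum]
    refine Finset.sum_congr rfl fun i _ => ?_
    rw [show (Pi.single i (z i) : Fin n → ℝ) = z i • Pi.single i 1 by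
      rw [← Pi.single_smul]; simp, map_smul, smul_eq_mul, mul_comm]
  have hw0 : ∀ i, 0 ≤ w i := by
    intro i
    -- `φ` is bounded below on the orthant above `x`, so a negative weight fails far enough along
    -- its axis; `M` is far enough.
    by_contra! hi
    set M := (|v - φ x|) / (-w i) with hM
    have hM0 : 0 ≤ M := div_nonneg (abs_nonneg _) (by linarith)
    have h1 := hv (x + M • Pi.single i 1) (by
      rw [Set.mem_Ici]
      refine le_add_of_nonneg_right (smul_nonneg hM0 ?_)
      simp)
    rw [map_add, map_smul, smul_eq_mul] at h1
    have h2 : M * w i = -|v - φ x| := by rw [hM, div_mul_eq_mul_div, div_neg, mul_div_cancel_right₀ _ hi.ne]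
    have h3 : φ (Pi.single i 1) = w i := rfl
    rw [h3, h2] at h1
    linarith [le_abs_self (v - φ x), neg_abs_le (v - φ x)]
  set τ := Tuple.sort w
  have hτ : Monotone (w ∘ τ) := Tuple.monotone_sort w
  -- By rearrangement, pairing `w` and `x` in the same order only increases the sum.
  have h1 : φ x ≤ ∑ i, (w ∘ τ) i * (x ∘ Tuple.sort x) i := by
    rw [hφ, ← Equiv.sum_comp τ]
    have := (hτ.monovary (Tuple.monotone_sort x)).sum_mul_comp_perm_le_sum_mul
      (σ := τ.trans (Tuple.sort x).symm)
    simpa using this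
  have h2 : ∑ i, (w ∘ τ) i * (x ∘ Tuple.sort x) i ≤ ∑ i, (w ∘ τ) i * (y ∘ Tuple.sort y) i := by
    rw [← sub_nonneg, ← Finset.sum_sub_distrib]
    simp_rw [← mul_sub]
    refine sum_mul_nonneg_of_monotone hτ (fun i => hw0 _) fun j => ?_
    rw [Finset.sum_sub_distrib, sub_nonneg]
    exact h j
  have h3 : ∑ i, (w ∘ τ) i * (y ∘ Tuple.sort y) i = φ (y ∘ (τ.symm.trans (Tuple.sort y))) := by
    rw [hφ, ← Equiv.sum_comp τ fun i => w i * (y ∘ (τ.symm.trans (Tuple.sort y))) i]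
    simp
  have h4 := hu _ (subset_convexHull ℝ _ ⟨τ.symm.trans (Tuple.sort y), rfl⟩)
  have h5 := hv x Set.self_mem_Ici
  simp only at h4
  linarith

/-- A symmetric, antitone, quasiconcave function on the nonnegative orthant reverses weak
submajorization. -/
theorem WeaklySubmajorizedBy.le_of_quasiconcaveOn {n : ℕ} {β : Type*} [LinearOrder β]
    {F : (Fin n → ℝ) → β} (hF : QuasiconcaveOn ℝ (Set.Ici 0) F) (hanti : AntitoneOn F (Set.Ici 0))
    (hsymm : ∀ c (σ : Equiv.Perm (Fin n)), F (c ∘ σ) = F c) {x y : Fin n → ℝ} (hx : 0 ≤ x)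
    (hy : 0 ≤ y) (h : WeaklySubmajorizedBy x y) : F y ≤ F x := by
  obtain ⟨z, hz, hxz⟩ := h.exists_le_mem_convexHull
  have hz' : z ∈ {c ∈ Set.Ici 0 | F y ≤ F c} := by
    refine convexHull_min ?_ (hF (F y)) hz
    rintro _ ⟨σ, rfl⟩
    exact ⟨fun i => hy (σ i), (hsymm y σ).ge⟩
  exact hz'.2.trans (hanti hx hz'.1 hxz)

/-! ### Perspective sublevel sets -/

/-- Joint convexity of the perspective `c ^ k * x ^ (1 - k)` of the power function. -/
theorem rpow_mul_rpow_one_sub_le {k l c d x y : ℝ} (hk : 1 ≤ k) (hl0 : 0 < l) (hl1 : l < 1)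
    (hc : 0 ≤ c) (hd : 0 ≤ d) (hx : 0 < x) (hy : 0 < y) :
    (l * c + (1 - l) * d) ^ k * (l * x + (1 - l) * y) ^ (1 - k) ≤
      l * (c ^ k * x ^ (1 - k)) + (1 - l) * (d ^ k * y ^ (1 - k)) := by
  have hl : 0 < 1 - l := sub_pos.2 hl1
  set Z := l * x + (1 - l) * y with hZ
  have hZ0 : 0 < Z := by positivity
  have persp : ∀ a z : ℝ, 0 ≤ a → 0 < z → a ^ k * z ^ (1 - k) = z * (a / z) ^ k := by
    intro a z ha hz
    rw [Real.rpow_sub hz, Real.rpow_one, Real.div_rpow ha hz.le]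
    ring
  -- Jensen for `u ^ k` at `c / x` and `d / y`, with weights `l * x / Z` and `(1 - l) * y / Z`.
  have key := (convexOn_rpow hk).2 (Set.mem_Ici.2 (div_nonneg hc hx.le))
    (Set.mem_Ici.2 (div_nonneg hd hy.le)) 
    (show 0 ≤ l * x / Z by positivity) (show 0 ≤ (1 - l) * y / Z by positivity)
    (by rw [← add_div, ← hZ, div_self hZ0.ne'])
  simp only [smul_eq_mul] at key
  rw [show l * x / Z * (c / x) + (1 - l) * y / Z * (d / y) = (l * c + (1 - l) * d) / Z by
    field_simp] at key
  rw [persp _ _ (by positivity) hZ0, persp _ _ hc hx, persp _ _ hd hy]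
  calc Z * ((l * c + (1 - l) * d) / Z) ^ k
      ≤ Z * (l * x / Z * (c / x) ^ k + (1 - l) * y / Z * (d / y) ^ k) := by gcongr
    _ = _ := by field_simp

/-- The positive vectors `y` at which the perspective sum with coefficients `c` is at most `t`. -/
def perspectiveSublevel {n : ℕ} (k t : ℝ) (c : Fin n → ℝ) : Set (Fin n → ℝ) :=
  {y | (∀ i, 0 < y i) ∧ ∑ i, c i ^ k * y i ^ (1 - k) ≤ t}

theorem measurableSet_perspectiveSublevel {n : ℕ} (k t : ℝ) (c : Fin n → ℝ) :
    MeasurableSet (perspectiveSublevel k t c) := by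
  have h1 : MeasurableSet {y : Fin n → ℝ | ∀ i, 0 < y i} := by
    rw [Set.ofPred_forall]
    exact MeasurableSet.iInter fun i => measurableSet_lt measurable_const (measurable_pi_apply i)
  have h2 : MeasurableSet {y : Fin n → ℝ | ∑ i, c i ^ k * y i ^ (1 - k) ≤ t} :=
    measurableSet_le (by fun_prop) measurable_const
  exact h1.inter h2

theorem convexCombination_mem_perspectiveSublevel {n : ℕ} {k t l : ℝ} (hk : 1 ≤ k) (hl0 : 0 < l)
    (hl1 : l < 1) {c d x y : Fin n → ℝ} (hc : 0 ≤ c) (hd : 0 ≤ d)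
    (hx : x ∈ perspectiveSublevel k t c) (hy : y ∈ perspectiveSublevel k t d) :
    l • x + (1 - l) • y ∈ perspectiveSublevel k t (l • c + (1 - l) • d) := by
  have hl : 0 < 1 - l := sub_pos.2 hl1
  refine ⟨fun i => ?_, ?_⟩
  · have := hx.1 i
    have := hy.1 i
    simp only [Pi.add_apply, Pi.smul_apply, smul_eq_mul]
    positivity
  · calc ∑ i, (l • c + (1 - l) • d) i ^ k * (l • x + (1 - l) • y) i ^ (1 - k)
        ≤ ∑ i, (l * (c i ^ k * x i ^ (1 - k)) + (1 - l) * (d i ^ k * y i ^ (1 - k))) :=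
          Finset.sum_le_sum fun i _ =>
            rpow_mul_rpow_one_sub_le hk hl0 hl1 (hc i) (hd i) (hx.1 i) (hy.1 i)
      _ = l * ∑ i, c i ^ k * x i ^ (1 - k) + (1 - l) * ∑ i, d i ^ k * y i ^ (1 - k) := by
          rw [Finset.sum_add_distrib, Finset.mul_sum, Finset.mul_sum]
      _ ≤ l * t + (1 - l) * t := by gcongr; exacts [hx.2, hy.2]
      _ = t := by ring

/-- Prékopa–Leindler on indicators of the sublevel sets gives log-concavity in `c`, and a weighted
geometric mean of values at least `r` is at least `r`. -/
theorem quasiconcaveOn_measure_perspectiveSublevel {n : ℕ} {k : ℝ} (hk : 1 ≤ k) (t : ℝ)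
    {ν : Measure (Fin n → ℝ)} (hν : ∀ l : ℝ, 0 < l → l < 1 → PrekopaLeindler l ν) :
    QuasiconcaveOn ℝ (Set.Ici 0) fun c => ν (perspectiveSublevel k t c) := by
  intro r
  rw [convex_iff_forall_pos]
  rintro c ⟨hc, hrc⟩ d ⟨hd, hrd⟩ l l' hl0 hl' hll
  obtain rfl : l' = 1 - l := by linarith
  have hl1 : l < 1 := sub_pos.1 hl'
  refine ⟨convex_Ici _ hc hd hl0.le hl'.le hll, ?_⟩
  have meas := measurableSet_perspectiveSublevel (n := n) k t
  have key := hν l hl0 hl1 _ _ _ (measurable_one.indicator (meas c))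
    (measurable_one.indicator (meas d))
    (measurable_one.indicator (meas (l • c + (1 - l) • d))) fun x y => by
      by_cases hx : x ∈ perspectiveSublevel k t c
      · by_cases hy : y ∈ perspectiveSublevel k t d
        · simp [hx, hy, convexCombination_mem_perspectiveSublevel hk hl0 hl1 hc hd hx hy]
        · simp [hy, hl1]
      · simp [hx, hl0]
  simp only [lintegral_indicator_one (meas _)] at key
  refine le_trans ?_ key
  conv_lhs => rw [← ENNReal.rpow_mul_rpow_self hl0 hl1 r]
  exact mul_le_mul' (ENNReal.rpow_le_rpow hrc hl0.le) (ENNReal.rpow_le_rpow hrd hl'.le)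

theorem perspectiveSublevel_antitoneOn {n : ℕ} {k : ℝ} (hk : 0 ≤ k) (t : ℝ) :
    AntitoneOn (perspectiveSublevel (n := n) k t) (Set.Ici 0) := by
  intro c hc d _ hcd y hy
  refine ⟨hy.1, (Finset.sum_le_sum fun i _ => ?_).trans hy.2⟩
  exact mul_le_mul_of_nonneg_right (Real.rpow_le_rpow (hc i) (hcd i) hk)
    (Real.rpow_nonneg (hy.1 i).le _)

theorem pi_perspectiveSublevel_comp_perm {n : ℕ} (k t : ℝ) (μ : Measure ℝ) [SigmaFinite μ]
    (c : Fin n → ℝ) (σ : Equiv.Perm (Fin n)) :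
    Measure.pi (fun _ => μ) (perspectiveSublevel k t (c ∘ σ)) =
      Measure.pi (fun _ => μ) (perspectiveSublevel k t c) := by
  have mp := measurePreserving_piCongrLeft (fun _ : Fin n => μ) σ
  rw [← mp.measure_preimage (measurableSet_perspectiveSublevel k t c).nullMeasurableSet]
  congr 1
  ext y
  have hy : ∀ i, MeasurableEquiv.piCongrLeft (fun _ => ℝ) σ y (σ i) = y i := fun i =>
    Equiv.piCongrLeft_apply_apply (fun _ => ℝ) σ y i
  simp only [perspectiveSublevel, Set.mem_ofPred_eq, Set.mem_preimage]
  rw [← σ.forall_congr_right (q := fun i => 0 < MeasurableEquiv.piCongrLeft (fun _ => ℝ) σ y i),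
    ← Equiv.sum_comp σ fun i =>
      c i ^ k * (MeasurableEquiv.piCongrLeft (fun _ => ℝ) σ y i) ^ (1 - k)]
  simp only [hy, Function.comp_apply]

/-! ### Passage to the random variables -/

theorem LogConcaveOn.ofReal_rpow_mul_le {g : ℝ → ℝ} (hg : LogConcaveOn Set.univ g) {l : ℝ}
    (hl0 : 0 < l) (hl1 : l < 1) (x y : ℝ) :
    ENNReal.ofReal (g x) ^ l * ENNReal.ofReal (g y) ^ (1 - l) ≤
      ENNReal.ofReal (g (l • x + (1 - l) • y)) := by
  have h0 : ∀ x, 0 ≤ g x := fun x => hg.2.1 x trivial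
  rw [ENNReal.ofReal_rpow_of_nonneg (h0 x) hl0.le,
    ENNReal.ofReal_rpow_of_nonneg (h0 y) (sub_pos.2 hl1).le,
    ← ENNReal.ofReal_mul (Real.rpow_nonneg (h0 x) _)]
  exact ENNReal.ofReal_le_ofReal (hg.2.2 x trivial y trivial l ⟨hl0.le, hl1.le⟩)

theorem HasDensity.ae_pos {Ω : Type*} [MeasurableSpace Ω] {P : Measure Ω} {Y : Ω → ℝ} {f : ℝ → ℝ}
    (h : HasDensity P Y f) (hf : ∀ x < 0, f x = 0) : ∀ᵐ ω ∂P, 0 < Y ω := by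
  refine (h.2.2.ae_iff (p := fun x => 0 < x) (by fun_prop)).2 ?_
  rw [ae_withDensity_iff (by have := h.1; fun_prop)]
  -- `f 0` is unconstrained, so the null set `{0}` is discarded.
  filter_upwards [Measure.ae_ne volume (0 : ℝ)] with x hx0 hx
  by_contra hx'
  exact hx (by simp [hf x (lt_of_le_of_ne (not_lt.1 hx') hx0)])

theorem corollary3p1 {n : ℕ} [NeZero n] {p q : ℝ} (hp : p < 0) (hq0 : 0 < q) (hq1 : q < 1)
    (hpq : p⁻¹ + q⁻¹ = 1)
    {Ω : Type*} [MeasurableSpace Ω] (P : Measure Ω) [IsProbabilityMeasure P]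
    (X : Fin n → Ω → ℝ) (hX : ∀ i, Measurable (X i)) (hindep : iIndepFun X P)
    (f : ℝ → ℝ) (hf : ∀ x < 0, f x = 0) (hdens : ∀ i, HasDensity P (X i) f)
    (hlc : ∃ g : ℝ → ℝ, HasDensity P (fun ω => X 0 ω ^ p) g ∧ LogConcaveOn Set.univ g)
    (a b : Fin n → ℝ) (ha : ∀ i, 0 ≤ a i) (hb : ∀ i, 0 ≤ b i)
    (hab : WeaklySubmajorizedBy (fun i => b i ^ q) (fun i => a i ^ q)) :
    StochLE P (fun ω => ∑ i, b i * X i ω) (fun ω => ∑ i, a i * X i ω) := by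
  obtain ⟨g, hg, hglc⟩ := hlc
  intro t
  set μ : Measure ℝ := volume.withDensity fun x => ENNReal.ofReal (g x) with hμ
  have hk : 1 ≤ q⁻¹ := (one_le_inv₀ hq0).2 hq1.le
  have hpk : p⁻¹ = 1 - q⁻¹ := by linarith
  have hrpow : Measurable fun x : ℝ => x ^ p := by fun_prop
  have hlaw : ∀ i, HasLaw (fun ω => X i ω ^ p) μ P := by
    intro i
    refine ⟨((hrpow.comp (hX i)).aemeasurable), ?_⟩
    refine Eq.trans ?_ hg.2.2.map_eq
    change P.map ((fun x : ℝ => x ^ p) ∘ X i) = P.map ((fun x : ℝ => x ^ p) ∘ X 0)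
    rw [← Measure.map_map hrpow (hX i), ← Measure.map_map hrpow (hX 0), (hdens i).2.2.map_eq,
      (hdens 0).2.2.map_eq]
  have : IsProbabilityMeasure μ := (hlaw 0).isProbabilityMeasure_iff.1 inferInstance
  have hpi : HasLaw (fun ω i => X i ω ^ p) (Measure.pi fun _ : Fin n => μ) P :=
    (hindep.comp (fun _ x => x ^ p) fun _ => hrpow).hasLaw_pi hlaw
  have hpos : ∀ᵐ ω ∂P, ∀ i, 0 < X i ω := ae_all_iff.2 fun i => (hdens i).ae_pos hf
  have hprob : ∀ c : Fin n → ℝ, (∀ i, 0 ≤ c i) → P {ω | ∑ i, c i * X i ω ≤ t} =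
      Measure.pi (fun _ => μ) (perspectiveSublevel q⁻¹ t fun i => c i ^ q) := by
    intro c hc
    rw [← hpi.map_eq, Measure.map_apply_of_aemeasurable hpi.aemeasurable
      (measurableSet_perspectiveSublevel _ _ _)]
    refine measure_congr ?_
    filter_upwards [hpos] with ω hω
    refine propext ?_
    have hterm : ∀ i, (c i ^ q) ^ q⁻¹ * (X i ω ^ p) ^ (1 - q⁻¹) = c i * X i ω := fun i => by
      rw [Real.rpow_rpow_inv (hc i) hq0.ne', ← hpk, Real.rpow_rpow_inv (hω i).le hp.ne]
    change ∑ i, c i * X i ω ≤ t ↔ (∀ i, 0 < X i ω ^ p) ∧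
      ∑ i, (c i ^ q) ^ q⁻¹ * (X i ω ^ p) ^ (1 - q⁻¹) ≤ t
    simp only [hterm, Real.rpow_pos_of_pos (hω _), implies_true, true_and]
  have hPL : ∀ l : ℝ, 0 < l → l < 1 → PrekopaLeindler l (Measure.pi fun _ : Fin n => μ) :=
    fun l hl0 hl1 => ((prekopaLeindler_volume hl0 hl1).withDensity hl0 hl1
      hg.1.ennreal_ofReal (hglc.ofReal_rpow_mul_le hl0 hl1)).pi n
  change P {ω | ∑ i, a i * X i ω ≤ t} ≤ P {ω | ∑ i, b i * X i ω ≤ t}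
  rw [hprob a ha, hprob b hb]
  exact hab.le_of_quasiconcaveOn
    (F := fun c => Measure.pi (fun _ => μ) (perspectiveSublevel q⁻¹ t c))
    (quasiconcaveOn_measure_perspectiveSublevel hk t hPL)
    (fun c hc d hd hcd => measure_mono
      (perspectiveSublevel_antitoneOn (zero_le_one.trans hk) t hc hd hcd))
    (pi_perspectiveSublevel_comp_perm q⁻¹ t μ) (fun i => Real.rpow_nonneg (hb i) q)
    fun i => Real.rpow_nonneg (ha i) q
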